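/- Let $n\ge 2$ and let $D_n$ be the dihedral group of order $2n$. Let $\Gamma_n$ be the generating graph of $D_n$: the simple graph with vertex set $D_n$ in which two distinct elements $x,y$ are adjacent if and only if $\langle x,y\rangle=D_n$. Let $A(n)$ be its adjacency matrix, let $n_0$ be the product of the distinct primes dividing $n$, let $k$ be the number of these primes, and let $\varphi$ and $\mu$ denote Euler's function and the Möbius function. Then the spectrum of $A(n)$, as a multiset of $2n$ real numbers, consists of - $0$ with multiplicity $2n-n_0-1$, - $\mu(d)\dfrac{\varphi(n)}{\varphi(d)}$ with multiplicity $\varphi(d)$, for each divisor $d>1$ of $n_0$, - $\dfrac{\varphi(n)+\sqrt{\varphi(n)^2+4n\varphi(n)}}{2}$ and $\dfrac{\varphi(n)-\sqrt{\varphi(n)^2+4n\varphi(n)}}{2}$, each with multiplicity $1$ (multiplicities are added when listed values coincide). Moreover, the adjacency energy $AE(n)$, that is, the sum of the absolute values of the eigenvalues of $A(n)$ counted with multiplicity, is $$AE(n)=\varphi(n)\,(2^k-1)+\sqrt{\varphi(n)^2+4n\varphi(n)}.$$ -/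

import Mathlib

/-- The generating graph of a group `G`: the vertex set is `G`, and two distinct elements are
adjacent exactly when together they generate `G`. -/
def generatingGraph (G : Type*) [Group G] : SimpleGraph G where
  Adj x y := x ≠ y ∧ Subgroup.closure {x, y} = ⊤
  symm := ⟨fun x y h => ⟨h.1.symm, by rw [Set.pair_comm]; exact h.2⟩⟩
  loopless := ⟨fun _ h => h.1 rfl⟩

open Classical in
/-- The adjacency spectrum of a finite graph: the multiset of the roots of the characteristic
polynomial of its real adjacency matrix. As this matrix is symmetric, these are all its
eigenvalues, counted with multiplicity. -/
noncomputable def adjSpectrum {V : Type*} [Fintype V] (G : SimpleGraph V) : Multiset ℝ :=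
  (G.adjMatrix ℝ).charpoly.roots

/-- The adjacency energy of a finite graph: the sum of the absolute values of the eigenvalues of
its adjacency matrix, counted with multiplicity. -/
noncomputable def adjEnergy {V : Type*} [Fintype V] (G : SimpleGraph V) : ℝ :=
  ((adjSpectrum G).map (fun x => |x|)).sum

namespace DihedralGroup

variable {n : ℕ}

/-! With the group split into rotations and reflections, the adjacency matrix has a zero rotation
block, mixed blocks given by the indicator of units, and the circulant of units on the reflections
(`reindex_adjMatrix_generatingGraph`). For `x ≠ 0`, a Schur complement reduces `det (x - A)` to `x ^
n` times a circulant determinant, which the additive characters diagonalise (`ZMod.det_circulant`).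
Its eigenvalues come from Ramanujan sums (`ZMod.sum_units_stdAddChar`): a character of order `d > 1`
gives `x - μ(d)φ(n)/φ(d)`, and there are `φ(d)` of them; the trivial one gives the quadratic factor.
Non-squarefree `d` only add zeros. -/

theorem closure_r_r_ne_top (i j : ZMod n) :
    Subgroup.closure {r i, r j} ≠ (⊤ : Subgroup (DihedralGroup n)) := by
  intro h
  have key : ∀ g ∈ Subgroup.closure {r i, r j}, ∃ a : ZMod n, g = r a := by
    intro g hg
    induction hg using Subgroup.closure_induction with
    | mem x hx => rcases hx with rfl | rfl <;> exact ⟨_, rfl⟩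
    | one => exact ⟨0, rfl⟩
    | mul x y _ _ hx hy =>
      obtain ⟨a, rfl⟩ := hx
      obtain ⟨b, rfl⟩ := hy
      exact ⟨_, r_mul_r a b⟩
    | inv x _ hx =>
      obtain ⟨a, rfl⟩ := hx
      exact ⟨_, inv_r a⟩
  obtain ⟨a, ha⟩ := key (sr 0) (h ▸ Subgroup.mem_top _)
  cases ha

/-- The rotations by multiples of `i` and the reflections with index in `j + (i)` form a subgroup;
if it is everything, `i` divides `1`. -/
theorem closure_r_sr_eq_top_iff (i j : ZMod n) :
    Subgroup.closure {r i, sr j} = (⊤ : Subgroup (DihedralGroup n)) ↔ IsUnit i := by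
  constructor
  · intro h
    have key : ∀ g ∈ Subgroup.closure {r i, sr j},
        (∃ a : ZMod n, g = r a ∧ i ∣ a) ∨ ∃ a : ZMod n, g = sr a ∧ i ∣ a - j := by
      intro g hg
      induction hg using Subgroup.closure_induction with
      | mem x hx =>
        rcases hx with rfl | rfl
        · exact .inl ⟨_, rfl, dvd_rfl⟩
        · exact .inr ⟨_, rfl, by simp⟩
      | one => exact .inl ⟨0, rfl, dvd_zero _⟩
      | mul x y _ _ hx hy =>
        obtain ⟨a, rfl, ha⟩ | ⟨a, rfl, ha⟩ := hx <;> obtain ⟨b, rfl, hb⟩ | ⟨b, rfl, hb⟩ := hy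
        · exact .inl ⟨_, r_mul_r a b, dvd_add ha hb⟩
        · exact .inr ⟨_, r_mul_sr a b, by convert dvd_sub hb ha using 1; ring⟩
        · exact .inr ⟨_, sr_mul_r a b, by convert dvd_add ha hb using 1; ring⟩
        · exact .inl ⟨_, sr_mul_sr a b, by convert dvd_sub hb ha using 1; ring⟩
      | inv x _ hx =>
        obtain ⟨a, rfl, ha⟩ | ⟨a, rfl, ha⟩ := hx
        · exact .inl ⟨_, inv_r a, (dvd_neg).2 ha⟩
        · exact .inr ⟨_, inv_sr a, ha⟩
    obtain ⟨a, ha, h1⟩ | ⟨a, ha, -⟩ := key (r 1) (h ▸ Subgroup.mem_top _)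
    · cases ha
      exact isUnit_of_dvd_one h1
    · cases ha
  · rintro ⟨u, rfl⟩
    have hr : ∀ a : ZMod n, r a ∈ Subgroup.closure {r (u : ZMod n), sr j} := by
      intro a
      have h := Subgroup.zpow_mem _ (Subgroup.subset_closure
        (Set.mem_insert (r (u : ZMod n)) {sr j})) ((↑u⁻¹ * a : ZMod n).cast : ℤ)
      simpa using h
    rw [eq_top_iff]
    rintro (a | a) -
    · exact hr a
    · have h := Subgroup.mul_mem _ (Subgroup.subset_closure
        (Set.mem_insert_of_mem (r (u : ZMod n)) (Set.mem_singleton (sr j)))) (hr (a - j))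
      simpa using h

theorem closure_sr_sr_eq_top_iff (i j : ZMod n) :
    Subgroup.closure {sr i, sr j} = (⊤ : Subgroup (DihedralGroup n)) ↔ IsUnit (i - j) := by
  rw [← closure_r_sr_eq_top_iff (i - j) j]
  suffices h : Subgroup.closure {sr i, sr j} = Subgroup.closure {r (i - j), sr j} by rw [h]
  apply le_antisymm <;> rw [Subgroup.closure_le] <;> rintro x (rfl | rfl)
  · have h := Subgroup.mul_mem _ (Subgroup.subset_closure
      (Set.mem_insert_of_mem (r (i - j)) (Set.mem_singleton (sr j))))
      (Subgroup.subset_closure (Set.mem_insert (r (i - j)) {sr j}))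
    simpa using h
  · exact Subgroup.subset_closure (by simp)
  · have h := Subgroup.mul_mem _ (Subgroup.subset_closure
      (Set.mem_insert_of_mem (sr i) (Set.mem_singleton (sr j))))
      (Subgroup.subset_closure (Set.mem_insert (sr i) {sr j}))
    simpa using h
  · exact Subgroup.subset_closure (by simp)

theorem generatingGraph_adj_r_r (i j : ZMod n) :
    ¬ (generatingGraph (DihedralGroup n)).Adj (r i) (r j) :=
  fun h => closure_r_r_ne_top i j h.2

theorem generatingGraph_adj_r_sr (i j : ZMod n) :
    (generatingGraph (DihedralGroup n)).Adj (r i) (sr j) ↔ IsUnit i := by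
  simp [generatingGraph, closure_r_sr_eq_top_iff]

/-- Distinctness is automatic because `0` is not a unit, which fails in `ZMod 1`. -/
theorem generatingGraph_adj_sr_sr (hn : n ≠ 1) (i j : ZMod n) :
    (generatingGraph (DihedralGroup n)).Adj (sr i) (sr j) ↔ IsUnit (i - j) := by
  have : Nontrivial (ZMod n) := ZMod.nontrivial_iff.2 hn
  simp only [generatingGraph, closure_sr_sr_eq_top_iff, ne_eq, sr.injEq, and_iff_right_iff_imp]
  rintro h rfl
  simp at h

end DihedralGroup

/-! ### Roots of unity and Ramanujan sums -/

theorem IsPrimitiveRoot.sum_nthRootsFinset {R : Type*} [CommRing R] [IsDomain R] {ζ : R} {n : ℕ}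
    (h : IsPrimitiveRoot ζ n) (hn : 1 < n) : ∑ x ∈ Polynomial.nthRootsFinset n (1 : R), x = 0 := by
  classical
  rw [← h.geom_sum_eq_zero hn]
  symm
  refine Finset.sum_bij (fun i _ => ζ ^ i) ?_ ?_ ?_ (fun _ _ => rfl)
  · intro i _
    rw [Polynomial.mem_nthRootsFinset (by omega), ← pow_mul, mul_comm, pow_mul, h.pow_eq_one,
      one_pow]
  · intro i hi j hj hij
    exact h.pow_inj (Finset.mem_range.1 hi) (Finset.mem_range.1 hj) hij
  · intro x hx
    have : NeZero n := ⟨by omega⟩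
    rw [Polynomial.mem_nthRootsFinset (by omega)] at hx
    obtain ⟨i, hi, rfl⟩ := h.eq_pow_of_pow_eq_one hx
    exact ⟨i, Finset.mem_range.2 hi, rfl⟩

/-- Möbius inversion: summed over `d ∣ m`, these sums give the sum of all `m`-th roots of unity,
which vanishes unless `m = 1`. -/
theorem Complex.sum_primitiveRoots (n : ℕ) (hn : 0 < n) :
    ∑ x ∈ primitiveRoots n ℂ, x = (ArithmeticFunction.moebius n : ℂ) := by
  classical
  have key := (ArithmeticFunction.sum_eq_iff_sum_mul_moebius_eq
    (f := fun d => ∑ x ∈ primitiveRoots d ℂ, x) (g := fun d => if d = 1 then (1 : ℂ) else 0)).1 ?_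
      n hn
  · rw [← key, Finset.sum_eq_single (n, 1)]
    · simp
    · rintro ⟨a, b⟩ h hne
      have hb : b ≠ 1 := by
        rintro rfl
        simp at h
        simp [h] at hne
      simp [hb]
    · intro h
      simp [hn.ne'] at h
  · intro m hm
    have : NeZero m := ⟨hm.ne'⟩
    rw [← Finset.sum_biUnion, ← IsPrimitiveRoot.nthRoots_one_eq_biUnion_primitiveRoots]
    · split_ifs with h1
      · subst h1
        have h1 : Polynomial.nthRootsFinset 1 (1 : ℂ) = {1} := by
          ext x
          simp [Polynomial.mem_nthRootsFinset one_pos]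
        simp [h1]
      · exact (Complex.isPrimitiveRoot_exp m hm.ne').sum_nthRootsFinset (by omega)
    · intro a _ b _ hab
      exact IsPrimitiveRoot.disjoint hab

theorem IsPrimitiveRoot.sum_units_pow_val {ζ : ℂ} {d : ℕ} [NeZero d] (h : IsPrimitiveRoot ζ d) :
    ∑ u : (ZMod d)ˣ, ζ ^ (u : ZMod d).val = (ArithmeticFunction.moebius d : ℂ) := by
  rw [← Complex.sum_primitiveRoots d (NeZero.pos d)]
  refine Finset.sum_bij (fun u _ => ζ ^ (u : ZMod d).val) ?_ ?_ ?_ (fun _ _ => rfl)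
  · intro u _
    rw [mem_primitiveRoots (NeZero.pos d)]
    exact h.pow_of_coprime _ (ZMod.val_coe_unit_coprime u)
  · intro u _ v _ huv
    exact Units.ext (ZMod.val_injective d
      (h.pow_inj (ZMod.val_lt _) (ZMod.val_lt _) huv))
  · intro x hx
    rw [mem_primitiveRoots (NeZero.pos d)] at hx
    obtain ⟨i, hi, hc, rfl⟩ := (h.isPrimitiveRoot_iff).1 hx
    refine ⟨ZMod.unitOfCoprime i hc, Finset.mem_univ _, ?_⟩
    rw [ZMod.coe_unitOfCoprime, ZMod.val_cast_of_lt hi]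

/-- All fibres have equal size; summing `F (f g * h)` in both orders shows this without division. -/
theorem MonoidHom.sum_comp_of_surjective {G H R : Type*} [Group G] [Group H] [Fintype G]
    [Fintype H] [Semiring R] (f : G →* H) (hf : Function.Surjective f) (F : H → R) :
    (Fintype.card H : R) * ∑ g, F (f g) = (Fintype.card G : R) * ∑ h, F h := by
  classical
  have h1 : ∑ g : G, ∑ h : H, F (f g * h) = (Fintype.card G : R) * ∑ h, F h := by
    rw [Finset.sum_congr rfl (g := fun _ => ∑ h, F h) (fun g _ =>
      Fintype.sum_equiv (Equiv.mulLeft (f g)) (fun h => F (f g * h)) F (fun _ => rfl))]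
    simp
  rw [← h1, Finset.sum_comm]
  have h2 : ∀ h : H, ∑ g : G, F (f g * h) = ∑ g, F (f g) := by
    intro h
    obtain ⟨k, rfl⟩ := hf h
    exact Fintype.sum_equiv (Equiv.mulRight k) _ _ (fun g => by simp)
  simp [h2]

theorem ZMod.isPrimitiveRoot_stdAddChar {n : ℕ} [NeZero n] (k : ZMod n) :
    IsPrimitiveRoot (ZMod.stdAddChar k) (addOrderOf k) := by
  rw [IsPrimitiveRoot.iff_def]
  constructor
  · rw [← AddChar.map_nsmul_eq_pow, addOrderOf_nsmul_eq_zero, AddChar.map_zero_eq_one]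
  · intro l hl
    rw [← AddChar.map_nsmul_eq_pow] at hl
    apply addOrderOf_dvd_of_nsmul_eq_zero
    exact ZMod.injective_stdAddChar (hl.trans (AddChar.map_zero_eq_one _).symm)

theorem ZMod.addOrderOf_dvd {n : ℕ} (k : ZMod n) : addOrderOf k ∣ n :=
  addOrderOf_dvd_of_nsmul_eq_zero (by simp)

/-- The evaluation of Ramanujan sums. -/
theorem ZMod.sum_units_stdAddChar {n : ℕ} [NeZero n] (k : ZMod n) :
    ∑ u : (ZMod n)ˣ, ZMod.stdAddChar ((u : ZMod n) * k) =
      (ArithmeticFunction.moebius (addOrderOf k) : ℂ) * (Nat.totient n : ℂ) /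
        (Nat.totient (addOrderOf k) : ℂ) := by
  have hdn := ZMod.addOrderOf_dvd k
  have hζ := ZMod.isPrimitiveRoot_stdAddChar k
  have hd : NeZero (addOrderOf k) := ⟨fun h => NeZero.ne n (by simpa [h] using hdn)⟩
  -- The character at `u * k` depends only on `u` modulo the order of `k`, so the sum descends to
  -- the units of that smaller modulus.
  have h := (ZMod.unitsMap hdn).sum_comp_of_surjective (ZMod.unitsMap_surjective hdn)
    (fun v => (ZMod.stdAddChar k : ℂ) ^ (v : ZMod (addOrderOf k)).val)
  rw [hζ.sum_units_pow_val, ZMod.card_units_eq_totient, ZMod.card_units_eq_totient] at h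
  have hφ : (Nat.totient (addOrderOf k) : ℂ) ≠ 0 := by
    exact_mod_cast (Nat.totient_pos.2 (NeZero.pos _)).ne'
  rw [eq_div_iff hφ, mul_comm, mul_comm (ArithmeticFunction.moebius (addOrderOf k) : ℂ), ← h]
  congr 1
  refine Finset.sum_congr rfl fun u _ => ?_
  have hu : (u : ZMod n) * k = (u : ZMod n).val • k := by simp
  rw [hu, AddChar.map_nsmul_eq_pow]
  have hv : ((ZMod.unitsMap hdn u : (ZMod (addOrderOf k))ˣ) : ZMod (addOrderOf k)).val
      = (u : ZMod n).val % addOrderOf k := by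
    rw [ZMod.unitsMap_val, ZMod.cast_eq_val, ZMod.val_natCast]
  rw [hv]
  exact (pow_mod_orderOf _ _).symm.trans (by rw [← hζ.eq_orderOf])

theorem ZMod.sum_ite_isUnit {n : ℕ} [NeZero n] {R : Type*} [AddCommMonoid R]
    [DecidablePred (IsUnit : ZMod n → Prop)] (f : ZMod n → R) :
    ∑ a : ZMod n, (if IsUnit a then f a else 0) = ∑ u : (ZMod n)ˣ, f u := by
  rw [← Finset.sum_filter]
  symm
  refine Finset.sum_bij (fun u _ => (u : ZMod n)) ?_ ?_ ?_ (fun _ _ => rfl)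
  · intro u _
    simp
  · intro u _ v _ h
    exact Units.ext h
  · intro a ha
    obtain ⟨u, rfl⟩ := (Finset.mem_filter.1 ha).2
    exact ⟨u, Finset.mem_univ _, rfl⟩

theorem ZMod.sum_comp_addOrderOf {n : ℕ} [NeZero n] {M : Type*} [AddCommMonoid M] (f : ℕ → M) :
    ∑ k ∈ (Finset.univ : Finset (ZMod n)).erase 0, f (addOrderOf k) =
      ∑ d ∈ n.divisors.erase 1, Nat.totient d • f d := by
  rw [← Finset.sum_fiberwise_of_maps_to (g := fun k : ZMod n => addOrderOf k)
    (t := n.divisors.erase 1)]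
  · refine Finset.sum_congr rfl fun d hd => ?_
    obtain ⟨hd1, hdn⟩ := Finset.mem_erase.1 hd
    rw [Finset.sum_congr rfl (g := fun _ => f d) (fun k hk => by
      rw [(Finset.mem_filter.1 hk).2]), Finset.sum_const,
      ← IsAddCyclic.card_addOrderOf_eq_totient (α := ZMod n) (d := d)
        (by rw [ZMod.card]; exact Nat.dvd_of_mem_divisors hdn)]
    congr 2
    ext k
    simp only [Finset.mem_filter, Finset.mem_erase, Finset.mem_univ, and_true, true_and,
      and_iff_right_iff_imp]
    rintro rfl rfl
    simp at hd1
  · intro k hk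
    simp only [Finset.mem_erase, Finset.mem_univ, and_true] at hk
    simp [ZMod.addOrderOf_dvd, NeZero.ne n, hk]

/-! ### Circulant determinants -/

open Matrix in
/-- Circulant matrices over `ZMod n` are diagonalised by the characters. -/
theorem ZMod.det_circulant {n : ℕ} [NeZero n] (v : ZMod n → ℂ) :
    (circulant v).det = ∏ k, ∑ j, v j * ZMod.stdAddChar (j * k) := by
  -- The columns of `F` are eigenvectors; the minus sign makes the eigenvalues match the stated
  -- sums. `F'` only serves to show `F` invertible.
  let F : Matrix (ZMod n) (ZMod n) ℂ := Matrix.of fun i k => ZMod.stdAddChar (-(i * k))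
  let F' : Matrix (ZMod n) (ZMod n) ℂ := Matrix.of fun i k => ZMod.stdAddChar (i * k)
  have hF : F * F' = (n : ℂ) • 1 := by
    ext i k
    have h := AddChar.sum_mulShift (k - i) (ZMod.isPrimitive_stdAddChar n)
    simp only [F, F', Matrix.mul_apply, Matrix.of_apply, ← AddChar.map_add_eq_mul]
    rw [Finset.sum_congr rfl (g := fun j => ZMod.stdAddChar (j * (k - i)))
      (fun j _ => by congr 1; ring), h]
    simp [Matrix.one_apply, sub_eq_zero, eq_comm]
  have hdet : F.det ≠ 0 := by
    intro h0
    have h := congrArg Matrix.det hF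
    rw [Matrix.det_mul, h0, zero_mul, Matrix.det_smul, Matrix.det_one, mul_one] at h
    exact pow_ne_zero _ (Nat.cast_ne_zero.2 (NeZero.ne n)) h.symm
  have hC : circulant v * F =
      F * Matrix.diagonal (fun k => ∑ j, v j * ZMod.stdAddChar (j * k)) := by
    ext i k
    rw [Matrix.mul_diagonal, Matrix.mul_apply, Finset.mul_sum]
    refine Fintype.sum_equiv (Equiv.subLeft i) _ _ fun j => ?_
    simp only [circulant_apply, F, Matrix.of_apply, Equiv.subLeft_apply]
    rw [mul_left_comm, ← AddChar.map_add_eq_mul]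
    congr 2
    ring
  have h := congrArg Matrix.det hC
  rw [Matrix.det_mul, Matrix.det_mul, Matrix.det_diagonal, mul_comm] at h
  exact mul_left_cancel₀ hdet h

open Matrix Polynomial

theorem adjSpectrum_eq {V : Type*} [Fintype V] [DecidableEq V] (G : SimpleGraph V)
    [DecidableRel G.Adj] : adjSpectrum G = (G.adjMatrix ℝ).charpoly.roots := by
  unfold adjSpectrum
  congr!

theorem Squarefree.card_divisors {n : ℕ} (hn : Squarefree n) :
    n.divisors.card = 2 ^ n.primeFactors.card := by
  rw [Nat.card_divisors hn.ne_zero]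
  refine Finset.prod_eq_pow_card fun p hp => ?_
  rw [Nat.factorization_eq_one_of_squarefree hn (Nat.prime_of_mem_primeFactors hp)
    (Nat.dvd_of_mem_primeFactors hp)]

/-! ### The characteristic polynomial -/

namespace DihedralGroup

variable {n : ℕ} [NeZero n]

open Classical in
/-- The adjacency matrix of the generating graph of the dihedral group, in block form. -/
theorem reindex_adjMatrix_generatingGraph (hn : n ≠ 1) :
    Matrix.reindex equivSum equivSum ((generatingGraph (DihedralGroup n)).adjMatrix ℂ) =
      fromBlocks 0 (Matrix.of fun i _ => if IsUnit i then 1 else 0)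
        (Matrix.of fun _ j => if IsUnit j then 1 else 0)
        (circulant fun a : ZMod n => if IsUnit a then 1 else 0) := by
  ext (i | i) (j | j)
  · simp [generatingGraph_adj_r_r]
  · simp [generatingGraph_adj_r_sr]
  · simp [SimpleGraph.adj_comm _ (sr i), generatingGraph_adj_r_sr]
  · simp [generatingGraph_adj_sr_sr hn, circulant_apply]

open Classical in
theorem eval_charpoly_adjMatrix_generatingGraph (hn : n ≠ 1) {x : ℂ} (hx : x ≠ 0) :
    ((generatingGraph (DihedralGroup n)).adjMatrix ℂ).charpoly.eval x =
      x ^ (n - 1) * (x ^ 2 - Nat.totient n * x - n * Nat.totient n) *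
        ∏ k ∈ (Finset.univ : Finset (ZMod n)).erase 0,
          (x - (ArithmeticFunction.moebius (addOrderOf k) : ℂ) * (Nat.totient n : ℂ) /
            (Nat.totient (addOrderOf k) : ℂ)) := by
  set c : ℂ := Nat.totient n / x with hc
  -- The Schur correction is the constant `c`, which nontrivial characters annihilate: it is felt
  -- only at `k = 0`.
  have hsum (k : ZMod n) : ∑ j : ZMod n, ((if j = 0 then x else 0) - (if IsUnit j then 1 else 0)
      - c) * ZMod.stdAddChar (j * k) = x - (ArithmeticFunction.moebius (addOrderOf k) : ℂ) *
        (Nat.totient n : ℂ) / (Nat.totient (addOrderOf k) : ℂ) - if k = 0 then c * n else 0 := by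
    have h1 := AddChar.sum_mulShift k (ZMod.isPrimitive_stdAddChar n)
    have h2 := ZMod.sum_ite_isUnit (fun j : ZMod n => (ZMod.stdAddChar (j * k) : ℂ))
    simp only [sub_mul, Finset.sum_sub_distrib, ← Finset.mul_sum, ite_mul, zero_mul, one_mul,
      h1, h2, ZMod.sum_units_stdAddChar]
    simp
  have hschur : (scalar (ZMod n ⊕ ZMod n) x - fromBlocks 0
        (Matrix.of fun i _ => if IsUnit i then 1 else 0)
        (Matrix.of fun _ j => if IsUnit j then 1 else 0)
        (circulant fun a : ZMod n => if IsUnit a then 1 else 0)).det =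
      x ^ n * (circulant fun a : ZMod n =>
        (if a = 0 then x else 0) - (if IsUnit a then 1 else 0) - c).det := by
    let _ : Invertible (x • (1 : Matrix (ZMod n) (ZMod n) ℂ)) :=
      ⟨x⁻¹ • 1, by simp [smul_smul, hx], by simp [smul_smul, hx]⟩
    have hinv : ⅟(x • (1 : Matrix (ZMod n) (ZMod n) ℂ)) = x⁻¹ • 1 := rfl
    have hblock : scalar (ZMod n ⊕ ZMod n) x - fromBlocks 0
        (Matrix.of fun i _ => if IsUnit i then 1 else 0)
        (Matrix.of fun _ j => if IsUnit j then 1 else 0)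
        (circulant fun a : ZMod n => if IsUnit a then 1 else 0) =
        fromBlocks (x • (1 : Matrix (ZMod n) (ZMod n) ℂ))
          (-(Matrix.of fun i _ => if IsUnit i then 1 else 0))
          (-(Matrix.of fun _ j => if IsUnit j then 1 else 0))
          (x • 1 - circulant fun a : ZMod n => if IsUnit a then 1 else 0) := by
      have hx1 : scalar (ZMod n ⊕ ZMod n) x = fromBlocks (x • 1) 0 0 (x • 1) := by
        ext (i | i) (j | j) <;> simp [scalar_apply, diagonal_apply, Matrix.one_apply]
      rw [hx1, sub_eq_add_neg, fromBlocks_neg, fromBlocks_add]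
      simp [sub_eq_add_neg]
    rw [hblock, det_fromBlocks₁₁, hinv, det_smul, det_one, mul_one, ZMod.card]
    congr 2
    ext i j
    have h2 := ZMod.sum_ite_isUnit (fun _ : ZMod n => (1 : ℂ))
    simp only [Finset.sum_const, Finset.card_univ, ZMod.card_units_eq_totient] at h2
    have h3 : ∑ j : ZMod n, (if IsUnit j then (if IsUnit j then x⁻¹ else 0) else 0) = c := by
      rw [hc, div_eq_mul_inv, ← nsmul_one, ← h2, Finset.sum_mul]
      refine Finset.sum_congr rfl fun j _ => ?_
      split_ifs <;> simp
    have h4 : ∑ j : ZMod n, (if IsUnit j then -(if IsUnit j then x⁻¹ else 0) else 0) = -c := by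
      rw [← h3, ← Finset.sum_neg_distrib]
      refine Finset.sum_congr rfl fun j _ => ?_
      split_ifs <;> simp
    simp [Matrix.mul_apply, circulant_apply, Matrix.one_apply, sub_eq_zero, h4]
  rw [← charpoly_reindex equivSum, reindex_adjMatrix_generatingGraph hn, eval_charpoly, hschur,
    ZMod.det_circulant, ← Finset.mul_prod_erase _ _ (Finset.mem_univ 0), hsum, ← mul_assoc]
  congr 1
  -- One of the `n` factors `x` clears the denominator of `x - φ(n) - n * φ(n) / x`.
  · obtain ⟨m, rfl⟩ := Nat.exists_eq_succ_of_ne_zero (NeZero.ne n)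
    simp [hc, pow_succ]
    field_simp
  · refine Finset.prod_congr rfl fun k hk => ?_
    rw [hsum, if_neg (Finset.ne_of_mem_erase hk), sub_zero]

open Classical in
theorem charpoly_adjMatrix_generatingGraph_complex (hn : n ≠ 1) :
    ((generatingGraph (DihedralGroup n)).adjMatrix ℂ).charpoly =
      X ^ (n - 1) * (X ^ 2 - C (Nat.totient n : ℂ) * X - C (n * Nat.totient n : ℂ)) *
        ∏ k ∈ (Finset.univ : Finset (ZMod n)).erase 0,
          (X - C ((ArithmeticFunction.moebius (addOrderOf k) : ℂ) * (Nat.totient n : ℂ) /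
            (Nat.totient (addOrderOf k) : ℂ))) := by
  apply eq_of_infinite_eval_eq
  refine (Set.finite_singleton (0 : ℂ)).infinite_compl.mono fun x hx => ?_
  rw [Set.mem_ofPred_eq, eval_charpoly_adjMatrix_generatingGraph hn hx]
  simp [eval_prod]

open Classical in
theorem charpoly_adjMatrix_generatingGraph (hn : n ≠ 1) :
    ((generatingGraph (DihedralGroup n)).adjMatrix ℝ).charpoly =
      X ^ (n - 1) * (X ^ 2 - C (Nat.totient n : ℝ) * X - C (n * Nat.totient n : ℝ)) *
        ∏ k ∈ (Finset.univ : Finset (ZMod n)).erase 0,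
          (X - C ((ArithmeticFunction.moebius (addOrderOf k) : ℝ) * (Nat.totient n : ℝ) /
            (Nat.totient (addOrderOf k) : ℝ))) := by
  -- Complex numbers were needed only for the characters; every factor is real.
  apply Polynomial.map_injective Complex.ofRealHom Complex.ofReal_injective
  have hmap : Complex.ofRealHom.mapMatrix ((generatingGraph (DihedralGroup n)).adjMatrix ℝ) =
      (generatingGraph (DihedralGroup n)).adjMatrix ℂ := by
    ext i j
    simp [SimpleGraph.adjMatrix_apply, apply_ite]
  rw [← charpoly_map, ← RingHom.mapMatrix_apply, hmap,
    charpoly_adjMatrix_generatingGraph_complex hn]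
  simp [Polynomial.map_prod]

end DihedralGroup

/-! ### Spectrum and energy -/

/-- The sum over the divisors of `n` that are not squarefree only contributes zeros. -/
theorem Nat.sum_divisors_replicate_moebius {n : ℕ} (hn : n ≠ 0) :
    ∑ d ∈ n.divisors.erase 1, Nat.totient d •
        ({(ArithmeticFunction.moebius d : ℝ) * (Nat.totient n : ℝ) / (Nat.totient d : ℝ)} :
          Multiset ℝ) =
      Multiset.replicate (n - UniqueFactorizationMonoid.radical n) 0 +
      ∑ d ∈ (UniqueFactorizationMonoid.radical n).divisors.erase 1,
        Multiset.replicate (Nat.totient d)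
          ((ArithmeticFunction.moebius d : ℝ) * (Nat.totient n : ℝ) / (Nat.totient d : ℝ)) := by
  have hrad : UniqueFactorizationMonoid.radical n ≠ 0 :=
    UniqueFactorizationMonoid.radical_ne_zero
  have hsub : (UniqueFactorizationMonoid.radical n).divisors ⊆ n.divisors :=
    Nat.divisors_subset_of_dvd hn UniqueFactorizationMonoid.radical_dvd_self
  have hsub' := Finset.erase_subset_erase 1 hsub
  simp only [Multiset.nsmul_singleton]
  rw [← Finset.sum_sdiff hsub']
  congr 1
  have hzero : ∀ d ∈ n.divisors.erase 1 \ (UniqueFactorizationMonoid.radical n).divisors.erase 1,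
      Multiset.replicate (Nat.totient d) ((ArithmeticFunction.moebius d : ℝ) *
        (Nat.totient n : ℝ) / (Nat.totient d : ℝ)) = Nat.totient d • ({0} : Multiset ℝ) := by
    intro d hd
    simp only [Finset.mem_sdiff, Finset.mem_erase, Nat.mem_divisors, not_and] at hd
    have hsq : ¬ Squarefree d := fun h => hd.2 hd.1.1
      ((UniqueFactorizationMonoid.dvd_radical_iff h.isRadical hn).2 hd.1.2.1) hrad
    rw [ArithmeticFunction.moebius_eq_zero_of_not_squarefree hsq, Multiset.nsmul_singleton]
    simp
  rw [Finset.sum_congr rfl hzero, ← Finset.sum_smul, Multiset.nsmul_singleton]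
  congr 1
  -- By `∑ φ(d) = m` over `d ∣ m`, for `m = n` and `m` the radical, the zeros number `n` minus the
  -- radical; the two removed terms `φ(1)` cancel.
  have h1 := Finset.sum_sdiff (f := Nat.totient) hsub'
  have h2 := Finset.add_sum_erase n.divisors Nat.totient (Nat.one_mem_divisors.2 hn)
  have h3 := Finset.add_sum_erase (UniqueFactorizationMonoid.radical n).divisors Nat.totient
    (Nat.one_mem_divisors.2 hrad)
  rw [Nat.sum_totient] at h2 h3
  omega

theorem mainTheorem4 (n : ℕ) [NeZero n] (hn : 2 ≤ n) :
    adjSpectrum (generatingGraph (DihedralGroup n)) =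
      Multiset.replicate (2 * n - UniqueFactorizationMonoid.radical n - 1) (0 : ℝ)
      + ∑ d ∈ (UniqueFactorizationMonoid.radical n).divisors.erase 1,
          Multiset.replicate (Nat.totient d)
            ((ArithmeticFunction.moebius d : ℝ) * (Nat.totient n : ℝ) / (Nat.totient d : ℝ))
      + {((Nat.totient n : ℝ) +
            Real.sqrt ((Nat.totient n : ℝ) ^ 2 + 4 * (n : ℝ) * (Nat.totient n : ℝ))) / 2,
         ((Nat.totient n : ℝ) -
            Real.sqrt ((Nat.totient n : ℝ) ^ 2 + 4 * (n : ℝ) * (Nat.totient n : ℝ))) / 2}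
    ∧ adjEnergy (generatingGraph (DihedralGroup n)) =
        (Nat.totient n : ℝ) * (2 ^ n.primeFactors.card - 1) +
          Real.sqrt ((Nat.totient n : ℝ) ^ 2 + 4 * (n : ℝ) * (Nat.totient n : ℝ)) := by
  set s := Real.sqrt ((Nat.totient n : ℝ) ^ 2 + 4 * (n : ℝ) * (Nat.totient n : ℝ)) with hs
  have hs2 : s ^ 2 = (Nat.totient n : ℝ) ^ 2 + 4 * (n : ℝ) * (Nat.totient n : ℝ) :=
    Real.sq_sqrt (by positivity)
  have hrad : UniqueFactorizationMonoid.radical n ≠ 0 :=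
    UniqueFactorizationMonoid.radical_ne_zero
  have hspec : adjSpectrum (generatingGraph (DihedralGroup n)) =
      Multiset.replicate (2 * n - UniqueFactorizationMonoid.radical n - 1) (0 : ℝ)
      + ∑ d ∈ (UniqueFactorizationMonoid.radical n).divisors.erase 1,
          Multiset.replicate (Nat.totient d)
            ((ArithmeticFunction.moebius d : ℝ) * (Nat.totient n : ℝ) / (Nat.totient d : ℝ))
      + {((Nat.totient n : ℝ) + s) / 2, ((Nat.totient n : ℝ) - s) / 2} := by
    have hquad : (X ^ 2 - C (Nat.totient n : ℝ) * X - C (n * Nat.totient n : ℝ)) =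
        (({((Nat.totient n : ℝ) + s) / 2, ((Nat.totient n : ℝ) - s) / 2} : Multiset ℝ).map
          (fun a => X - C a)).prod := by
      have h1 : (Nat.totient n : ℝ) = (Nat.totient n + s) / 2 + (Nat.totient n - s) / 2 := by ring
      have h2 : (n * Nat.totient n : ℝ) =
          -((Nat.totient n + s) / 2 * ((Nat.totient n - s) / 2)) := by linarith
      rw [h2]
      nth_rw 1 [h1]
      simp only [Multiset.insert_eq_cons, Multiset.map_cons, Multiset.map_singleton,
        Multiset.prod_cons, Multiset.prod_singleton, C_add, C_neg, C_mul]
      ring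
    have hprod : ∏ k ∈ (Finset.univ : Finset (ZMod n)).erase 0,
        (X - C ((ArithmeticFunction.moebius (addOrderOf k) : ℝ) * (Nat.totient n : ℝ) /
          (Nat.totient (addOrderOf k) : ℝ))) =
        ((∑ k ∈ (Finset.univ : Finset (ZMod n)).erase 0,
          ({(ArithmeticFunction.moebius (addOrderOf k) : ℝ) * (Nat.totient n : ℝ) /
          (Nat.totient (addOrderOf k) : ℝ)} : Multiset ℝ)).map (fun a => X - C a)).prod := by
      rw [← Multiset.coe_mapAddMonoidHom, map_sum, Multiset.prod_sum]
      simp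
    have hpow : (X : ℝ[X]) ^ (n - 1) =
        ((Multiset.replicate (n - 1) (0 : ℝ)).map (fun a => X - C a)).prod := by
      simp
    classical
    rw [adjSpectrum_eq, DihedralGroup.charpoly_adjMatrix_generatingGraph (by omega), hpow, hquad,
      hprod, ← Multiset.prod_add, ← Multiset.prod_add, ← Multiset.map_add, ← Multiset.map_add,
      roots_multiset_prod_X_sub_C,
      ZMod.sum_comp_addOrderOf (fun d => ({(ArithmeticFunction.moebius d : ℝ) *
        (Nat.totient n : ℝ) / (Nat.totient d : ℝ)} : Multiset ℝ)),
      Nat.sum_divisors_replicate_moebius (by omega)]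
    have hle := Nat.le_of_dvd (by omega)
      (UniqueFactorizationMonoid.radical_dvd_self : UniqueFactorizationMonoid.radical n ∣ n)
    -- Zeros come from `X ^ (n - 1)` and from the non-squarefree divisors.
    have hcard : 2 * n - UniqueFactorizationMonoid.radical n - 1 =
        (n - 1) + (n - UniqueFactorizationMonoid.radical n) := by omega
    rw [hcard, Multiset.replicate_add]
    abel
  refine ⟨hspec, ?_⟩
  -- Hence the second quadratic root is nonpositive, and the two absolute values add up to `s`.
  have hφs : (Nat.totient n : ℝ) ≤ s := Real.le_sqrt_of_sq_le (by
    have : (0 : ℝ) ≤ 4 * (n : ℝ) * (Nat.totient n : ℝ) := by positivity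
    linarith)
  have hφ : (0 : ℝ) ≤ Nat.totient n := by positivity
  -- Multiplicity `φ(d)` cancels the denominator, so each such `d` adds the same amount to the
  -- energy.
  have hterm : ∀ d ∈ (UniqueFactorizationMonoid.radical n).divisors.erase 1,
      ((Multiset.replicate (Nat.totient d) ((ArithmeticFunction.moebius d : ℝ) *
        (Nat.totient n : ℝ) / (Nat.totient d : ℝ))).map (fun x => |x|)).sum =
        (Nat.totient n : ℝ) := by
    intro d hd
    have hdvd := Nat.dvd_of_mem_divisors (Finset.mem_of_mem_erase hd)
    have hsq : Squarefree d :=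
      UniqueFactorizationMonoid.squarefree_radical.squarefree_of_dvd hdvd
    have hμ : |(ArithmeticFunction.moebius d : ℝ)| = 1 := by
      exact_mod_cast ArithmeticFunction.abs_moebius_eq_one_of_squarefree hsq
    have hd0 : (Nat.totient d : ℝ) ≠ 0 := by
      exact_mod_cast (Nat.totient_pos.2 (Nat.pos_of_dvd_of_pos hdvd (Nat.pos_of_ne_zero hrad))).ne'
    rw [Multiset.map_replicate, Multiset.sum_replicate, abs_div, abs_mul, hμ, one_mul,
      Nat.abs_cast, Nat.abs_cast, nsmul_eq_mul, mul_div_cancel₀ _ hd0]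
  have hcard : (((UniqueFactorizationMonoid.radical n).divisors.erase 1).card : ℝ) =
      2 ^ n.primeFactors.card - 1 := by
    rw [Finset.card_erase_of_mem (Nat.one_mem_divisors.2 hrad),
      Nat.cast_sub (Finset.card_pos.2 ⟨1, Nat.one_mem_divisors.2 hrad⟩),
      UniqueFactorizationMonoid.squarefree_radical.card_divisors, Nat.primeFactors_radical]
    simp
  rw [adjEnergy, hspec, Multiset.map_add, Multiset.map_add, Multiset.sum_add, Multiset.sum_add,
    ← Multiset.coe_mapAddMonoidHom, map_sum, Multiset.sum_sum,
    Multiset.coe_mapAddMonoidHom, Finset.sum_congr rfl hterm, Finset.sum_const, nsmul_eq_mul,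
    hcard]
  have ha : |((Nat.totient n : ℝ) + s) / 2| = (Nat.totient n + s) / 2 :=
    abs_of_nonneg (by linarith)
  have hb : |((Nat.totient n : ℝ) - s) / 2| = -((Nat.totient n - s) / 2) :=
    abs_of_nonpos (by linarith)
  simp [ha, hb]
  ring
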